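/- Let $\{a,b\}^*$ be the free monoid on the two letters $a,b$. For coprime positive integers $p,q$ and $n=p+q$, the proper (lower) Christoffel word of slope $p/q$ is the word $x_1\cdots x_n$ with $x_i=a$ if $(ip \bmod n) > ((i-1)p \bmod n)$ and $x_i=b$ otherwise ($1\le i\le n$). A word is a Christoffel word if it is one of the letters $a$, $b$ or a proper Christoffel word; let $\mathrm{CH}$ be the set of all Christoffel words. Let $\mathcal{M}_{CH}$ be the monoid, under composition, of all endomorphisms $f$ of $\{a,b\}^*$ such that $f(w)\in\mathrm{CH}$ for every $w\in\mathrm{CH}$. Let $\lambda_a,\lambda_b$ be the endomorphisms of $\{a,b\}^*$ given by $\lambda_a\colon a\mapsto a,\ b\mapsto ab$ and $\lambda_b\colon a\mapsto ab,\ b\mapsto b$. For $v=v_1v_2\cdots v_n\in\{a,b\}^*$ (with $v_i$ letters) put $\lambda_v=\lambda_{v_1}\circ\lambda_{v_2}\circ\cdots\circ\lambda_{v_n}$, with $\lambda_\varepsilon=\mathrm{id}$ for the empty word $\varepsilon$. Then: 1. $\mathcal{M}_{CH}=\{\lambda_a,\lambda_b\}^*$, the submonoid of the endomorphism monoid of $\{a,b\}^*$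 generated by $\lambda_a$ and $\lambda_b$. 2. For all $v,w\in\{a,b\}^*$, if $\lambda_v(w)\in\mathrm{CH}$, then $w\in\mathrm{CH}$. -/

import Mathlib

namespace ChristoffelWords

/-- The two-letter alphabet `{a, b}`. -/
inductive Letter : Type
  | a
  | b
  deriving DecidableEq

/-- Words over `{a, b}`: the free monoid on the alphabet. -/
abbrev Word : Type := FreeMonoid Letter

/-- The word `x₁ ⋯ xₙ` with `n = p + q`, where `xᵢ = a` if `i p mod n > (i - 1) p mod n`, and
`xᵢ = b` otherwise. (In the code `j = i - 1` ranges over `0, …, n - 1`.) -/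
def christoffelWord (p q : ℕ) : Word :=
  FreeMonoid.ofList ((List.range (p + q)).map fun j =>
    if (j * p) % (p + q) < ((j + 1) * p) % (p + q) then Letter.a else Letter.b)

/-- (Lower) Christoffel words: the letters `a` and `b` (slopes `0/1` and `1/0`), and the
proper Christoffel words, of slope `p/q` with `p` and `q` coprime positive integers. -/
inductive IsChristoffel : Word → Prop
  | letter (x : Letter) : IsChristoffel (FreeMonoid.of x)
  | proper (p q : ℕ) (hp : 0 < p) (hq : 0 < q) (hpq : Nat.Coprime p q) :
      IsChristoffel (christoffelWord p q)

/-- The morphism `λ_a : a ↦ a, b ↦ ab`. -/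
def lamA : Monoid.End Word :=
  FreeMonoid.lift fun
    | Letter.a => FreeMonoid.of Letter.a
    | Letter.b => FreeMonoid.of Letter.a * FreeMonoid.of Letter.b

/-- The morphism `λ_b : a ↦ ab, b ↦ b`. -/
def lamB : Monoid.End Word :=
  FreeMonoid.lift fun
    | Letter.a => FreeMonoid.of Letter.a * FreeMonoid.of Letter.b
    | Letter.b => FreeMonoid.of Letter.b

/-- `λ_v = λ_{v₁} ∘ ⋯ ∘ λ_{vₙ}` for `v = v₁ ⋯ vₙ`, with `λ_ε = id`
(multiplication in `Monoid.End Word` is composition). -/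
def lam : Word →* Monoid.End Word :=
  FreeMonoid.lift fun
    | Letter.a => lamA
    | Letter.b => lamB

/-- The monoid of Christoffel morphisms: the endomorphisms of `{a, b}^*` that map every
Christoffel word to a Christoffel word. -/
def christoffelMorphisms : Submonoid (Monoid.End Word) where
  carrier := {f | ∀ w : Word, IsChristoffel w → IsChristoffel (f w)}
  one_mem' := fun _ hw => hw
  mul_mem' := fun hf hg w hw => hf _ (hg w hw)

end ChristoffelWords

/-! A Christoffel word codes the orbit of 0 under the exchange of two intervals on `{0, …, p + q -
1}`: add `p` below `q`, subtract `q` otherwise. Such a coding is determined by its length, and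
`λ_a`, `λ_b` turn codings for `(p, q)` into codings for `(p, p + q)` and `(p + q, q)`. Hence both
preserve Christoffel words, and subtractive Euclid (`IsChristoffel.cases_lam`) reduces each
Christoffel word to `ab` or a letter. As both maps are injective and their images share only powers
of `ab`, they also reflect Christoffel words. For a Christoffel morphism `f`, `f(ab)` is `ab` (then
`f = 1`) or lies in the image of `λ_a` or `λ_b`. The cut between `f(a)` and `f(b)` respects that
image, so `f = λ_x ∘ g`; `g` is again Christoffel by reflection, and `g(ab)` is shorter. -/

namespace ChristoffelWords

open Letter

/-! ### The morphisms `λ_a` and `λ_b` on lists -/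

/-- `λ_a` as a function on lists. -/
def expandA : List Letter → List Letter
  | [] => []
  | a :: w => a :: expandA w
  | b :: w => a :: b :: expandA w

/-- `λ_b` as a function on lists. -/
def expandB : List Letter → List Letter
  | [] => []
  | a :: w => a :: b :: expandB w
  | b :: w => b :: expandB w

theorem toList_lamA (w : Word) : (lamA w).toList = expandA w.toList := by
  induction w using FreeMonoid.inductionOn' with
  | one => simp [expandA]
  | of_mul x w ih => rw [map_mul, FreeMonoid.toList_mul, ih]; cases x <;> rfl

theorem toList_lamB (w : Word) : (lamB w).toList = expandB w.toList := by
  induction w using FreeMonoid.inductionOn' with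
  | one => simp [expandB]
  | of_mul x w ih => rw [map_mul, FreeMonoid.toList_mul, ih]; cases x <;> rfl

theorem expandA_ne_cons_b (u w : List Letter) : expandA u ≠ b :: w := by
  rcases u with _ | ⟨_ | _, u⟩ <;> simp [expandA]

/-- Decoding needs one letter of lookahead: after an `a`, a `b` follows exactly when the source
letter is `b`, since no image begins with `b`. -/
theorem expandA_injective : Function.Injective expandA := by
  intro u
  induction u with
  | nil => rintro (_ | ⟨_ | _, w⟩) h <;> simp_all [expandA]
  | cons x u ih =>
    rintro (_ | ⟨_ | _, w⟩) h <;> cases x <;> simp [expandA] at h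
    · rw [ih h]
    · exact absurd h.symm (expandA_ne_cons_b _ _)
    · exact absurd h (expandA_ne_cons_b _ _)
    · rw [ih h]

theorem expandB_injective : Function.Injective expandB := by
  intro u
  induction u with
  | nil => rintro (_ | ⟨_ | _, w⟩) h <;> simp_all [expandB]
  | cons x u ih =>
    rintro (_ | ⟨_ | _, w⟩) h <;> cases x <;> simp [expandB] at h
    · rw [ih h]
    · rw [ih h]

theorem lamA_injective : Function.Injective lamA := fun u w h =>
  FreeMonoid.toList.injective <| expandA_injective <| by rw [← toList_lamA, ← toList_lamA, h]

theorem lamB_injective : Function.Injective lamB := fun u w h =>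
  FreeMonoid.toList.injective <| expandB_injective <| by rw [← toList_lamB, ← toList_lamB, h]

theorem length_expandA (w : List Letter) : (expandA w).length = w.length + w.count b := by
  induction w with
  | nil => rfl
  | cons x w ih => cases x <;> simp [expandA, ih] <;> omega

theorem length_expandB (w : List Letter) : (expandB w).length = w.length + w.count a := by
  induction w with
  | nil => rfl
  | cons x w ih => cases x <;> simp [expandB, ih] <;> omega

theorem count_b_expandA (w : List Letter) : (expandA w).count b = w.count b := by
  induction w with
  | nil => rfl
  | cons x w ih => cases x <;> simp [expandA, ih]

theorem count_a_expandB (w : List Letter) : (expandB w).count a = w.count a := by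
  induction w with
  | nil => rfl
  | cons x w ih => cases x <;> simp [expandB, ih]

theorem length_eq_count_add_count (w : List Letter) : w.length = w.count a + w.count b := by
  induction w with
  | nil => rfl
  | cons x w ih => cases x <;> simp [ih] <;> omega

theorem append_b_b_ne_expandA (u z : List Letter) : z ++ [b, b] ≠ expandA u := by
  induction u generalizing z with
  | nil => simp [expandA]
  | cons x u ih =>
    intro h
    cases x <;> rcases z with _ | ⟨y, z⟩ <;> simp [expandA] at h
    · exact ih z h.2
    · rcases z with _ | ⟨y, z⟩ <;> simp at h
      · exact expandA_ne_cons_b _ _ h.2.symm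
      · exact ih z h.2.2

/-- A factorization of a word in the image of `λ_a` comes from a factorization of the preimage,
unless it separates a `b` from the `a` before it. -/
theorem exists_expandA_of_append {u x y : List Letter} (h : x ++ y = expandA u)
    (hy : ∀ z, y ≠ b :: z) : ∃ x' y', x = expandA x' ∧ y = expandA y' := by
  induction u generalizing x with
  | nil => simp only [expandA, List.append_eq_nil_iff] at h; exact ⟨[], [], h.1, h.2⟩
  | cons c u ih =>
    rcases x with _ | ⟨d, x⟩
    · exact ⟨[], c :: u, rfl, h⟩
    · cases c <;> simp only [expandA, List.cons_append, List.cons.injEq] at h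
      · obtain ⟨x', y', rfl, rfl⟩ := ih h.2
        exact ⟨a :: x', y', by simp [expandA, h.1], rfl⟩
      · rcases x with _ | ⟨e, x⟩
        · exact absurd h.2 (hy _)
        · simp only [List.cons_append, List.cons.injEq] at h
          obtain ⟨x', y', rfl, rfl⟩ := ih h.2.2
          exact ⟨b :: x', y', by simp [expandA, h.1, h.2.1], rfl⟩

/-- A factorization of a word in the image of `λ_b` comes from a factorization of the preimage,
unless it separates an `a` from the `b` after it. -/
theorem exists_expandB_of_append {u x y : List Letter} (h : x ++ y = expandB u)
    (hx : ∀ z, x ≠ z ++ [a]) : ∃ x' y', x = expandB x' ∧ y = expandB y' := by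
  induction u generalizing x with
  | nil => simp only [expandB, List.append_eq_nil_iff] at h; exact ⟨[], [], h.1, h.2⟩
  | cons c u ih =>
    rcases x with _ | ⟨d, x⟩
    · exact ⟨[], c :: u, rfl, h⟩
    · cases c <;> simp only [expandB, List.cons_append, List.cons.injEq] at h
      · rcases x with _ | ⟨e, x⟩
        · exact absurd (by simp [h.1]) (hx [])
        · simp only [List.cons_append, List.cons.injEq] at h
          obtain ⟨x', y', rfl, rfl⟩ := ih h.2.2 fun z hz => hx (d :: e :: z) (by simp [hz])
          exact ⟨a :: x', y', by simp [expandB, h.1, h.2.1], rfl⟩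
      · obtain ⟨x', y', rfl, rfl⟩ := ih h.2 fun z hz => hx (d :: z) (by simp [hz])
        exact ⟨b :: x', y', by simp [expandB, h.1], rfl⟩

/-! ### Christoffel words as codings of an exchange of two intervals -/

/-- `Codes p q s w t`: the word `w` records a walk from `s` to `t`, whose steps are `+ p` from
the integers below `q` (letter `a`) and `- q` from the others (letter `b`). -/
def Codes (p q : ℕ) : ℕ → List Letter → ℕ → Prop
  | s, [], t => s = t
  | s, a :: w, t => s < q ∧ Codes p q (s + p) w t
  | s, b :: w, t => q ≤ s ∧ Codes p q (s - q) w t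

/-- The walk is deterministic: comparing `s` with `q` fixes the next letter. -/
theorem Codes.unique {p q s t t' : ℕ} {w w' : List Letter} (h : Codes p q s w t)
    (h' : Codes p q s w' t') (hl : w.length = w'.length) : w = w' := by
  induction w generalizing s w' with
  | nil => exact (List.length_eq_zero_iff.1 hl.symm).symm
  | cons x w ih =>
    rcases w' with _ | ⟨y, w'⟩
    · simp at hl
    · have hl' : w.length = w'.length := by simpa using hl
      cases x <;> cases y <;> simp only [Codes] at h h'
      · rw [ih h.2 h'.2 hl']
      · omega
      · omega
      · rw [ih h.2 h'.2 hl']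

theorem Codes.add_eq {p q s t : ℕ} {w : List Letter} (h : Codes p q s w t) :
    s + p * w.count a = t + q * w.count b := by
  induction w generalizing s with
  | nil => simpa [Codes] using h
  | cons x w ih =>
    cases x <;> simp only [Codes] at h <;> have := ih h.2 <;> simp [mul_add] <;> omega

/-- A step `- q` becomes `+ p` followed by `- (p + q)`. Both letter images start with `a`, so the
position must lie below the new threshold `p + q`. -/
theorem Codes.expandA {p q s t : ℕ} {w : List Letter} (h : Codes p q s w t) (hs : s < p + q) :
    Codes p (p + q) s (expandA w) t := by
  induction w generalizing s with
  | nil => exact h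
  | cons x w ih =>
    cases x <;> simp only [Codes, ChristoffelWords.expandA] at h ⊢
    · exact ⟨hs, ih h.2 (by omega)⟩
    · refine ⟨hs, by omega, ?_⟩
      rw [show s + p - (p + q) = s - q by omega]
      exact ih h.2 (by omega)

/-- A step `+ p` becomes `+ (p + q)` followed by `- q`. -/
theorem Codes.expandB {p q s t : ℕ} {w : List Letter} (h : Codes p q s w t) :
    Codes (p + q) q s (expandB w) t := by
  induction w generalizing s with
  | nil => exact h
  | cons x w ih =>
    cases x <;> simp only [Codes, ChristoffelWords.expandB] at h ⊢
    · refine ⟨h.1, by omega, ?_⟩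
      rw [show s + (p + q) - q = s + p by omega]
      exact ih h.2
    · exact ⟨h.1, ih h.2⟩

/-- The position after `j` steps is `j * p` mod `p + q`; adding `p` avoids wrapping exactly when
this residue is below `q`. -/
theorem codes_range' {p q : ℕ} (hp : 0 < p) (hq : 0 < q) (k j : ℕ) :
    Codes p q (j * p % (p + q)) ((List.range' j k).map fun j =>
      if (j * p) % (p + q) < ((j + 1) * p) % (p + q) then Letter.a else Letter.b)
      ((j + k) * p % (p + q)) := by
  induction k generalizing j with
  | zero => simp [Codes]
  | succ k ih =>
    have ih := ih (j + 1)
    rw [show j + 1 + k = j + (k + 1) by ring] at ih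
    have hr : j * p % (p + q) < p + q := Nat.mod_lt _ (by omega)
    have hstep : (j + 1) * p % (p + q) = (j * p % (p + q) + p) % (p + q) := by
      rw [add_mul, one_mul, Nat.mod_add_mod]
    rw [List.range'_succ, List.map_cons]
    by_cases hlt : j * p % (p + q) < q
    · have e : (j + 1) * p % (p + q) = j * p % (p + q) + p := by
        rw [hstep, Nat.mod_eq_of_lt (by omega)]
      rw [if_pos (by omega)]
      exact ⟨hlt, e ▸ ih⟩
    · have e : (j + 1) * p % (p + q) = j * p % (p + q) - q := by
        rw [hstep, Nat.mod_eq_sub_mod (by omega), Nat.mod_eq_of_lt (by omega)]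
        omega
      rw [if_neg (by omega)]
      exact ⟨by omega, e ▸ ih⟩

theorem length_christoffelWord (p q : ℕ) : (christoffelWord p q).toList.length = p + q := by
  simp [christoffelWord]

theorem codes_christoffelWord {p q : ℕ} (hp : 0 < p) (hq : 0 < q) :
    Codes p q 0 (christoffelWord p q).toList 0 := by
  simpa [christoffelWord, List.range_eq_range'] using codes_range' hp hq (p + q) 0

theorem eq_christoffelWord {p q t : ℕ} (hp : 0 < p) (hq : 0 < q) {w : Word}
    (h : Codes p q 0 w.toList t) (hl : w.toList.length = p + q) : w = christoffelWord p q :=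
  FreeMonoid.toList.injective <| h.unique (codes_christoffelWord hp hq) <| by
    rw [hl, length_christoffelWord]

theorem count_a_christoffelWord {p q : ℕ} (hp : 0 < p) (hq : 0 < q) :
    (christoffelWord p q).toList.count a = q := by
  have h := (codes_christoffelWord hp hq).add_eq
  have hl := length_christoffelWord p q
  rw [length_eq_count_add_count] at hl
  -- The walk is closed, so `p` times the number of `a`'s is `q` times the number of `b`'s; the two
  -- numbers sum to `p + q`.
  refine Nat.eq_of_mul_eq_mul_right (show 0 < p + q by omega) ?_
  nlinarith

theorem count_b_christoffelWord {p q : ℕ} (hp : 0 < p) (hq : 0 < q) :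
    (christoffelWord p q).toList.count b = p := by
  have hl := length_christoffelWord p q
  rw [length_eq_count_add_count, count_a_christoffelWord hp hq] at hl
  omega

theorem lamA_christoffelWord {p q : ℕ} (hp : 0 < p) (hq : 0 < q) :
    lamA (christoffelWord p q) = christoffelWord p (p + q) := by
  refine eq_christoffelWord hp (by omega) (t := 0) ?_ ?_ <;> rw [toList_lamA]
  · exact (codes_christoffelWord hp hq).expandA (by omega)
  · rw [length_expandA, length_christoffelWord, count_b_christoffelWord hp hq]
    omega

theorem lamB_christoffelWord {p q : ℕ} (hp : 0 < p) (hq : 0 < q) :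
    lamB (christoffelWord p q) = christoffelWord (p + q) q := by
  refine eq_christoffelWord (by omega) hq (t := 0) ?_ ?_ <;> rw [toList_lamB]
  · exact (codes_christoffelWord hp hq).expandB
  · rw [length_expandB, length_christoffelWord, count_a_christoffelWord hp hq]

theorem lamA_of_a : lamA (FreeMonoid.of a) = FreeMonoid.of a := rfl

theorem lamA_of_b : lamA (FreeMonoid.of b) = christoffelWord 1 1 := rfl

theorem lamB_of_a : lamB (FreeMonoid.of a) = christoffelWord 1 1 := rfl

theorem lamB_of_b : lamB (FreeMonoid.of b) = FreeMonoid.of b := rfl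

/-! ### First and last letters -/

theorem IsChristoffel.toList_ne_nil {w : Word} (h : IsChristoffel w) : w.toList ≠ [] := by
  rcases h with x | ⟨p, q, hp, hq, -⟩
  · simp
  · rw [Ne, ← List.length_eq_zero_iff, length_christoffelWord]
    omega

theorem IsChristoffel.eq_b {w : Word} (h : IsChristoffel w) {z : List Letter}
    (hz : w.toList = b :: z) : w.toList = [b] := by
  rcases h with x | ⟨p, q, hp, hq, -⟩
  · simp_all
  · have := codes_christoffelWord hp hq
    rw [hz] at this
    exact absurd this.1 (by omega)

theorem IsChristoffel.eq_a {w : Word} (h : IsChristoffel w) {z : List Letter}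
    (hz : w.toList = z ++ [a]) : w.toList = [a] := by
  rcases h with x | ⟨p, q, hp, hq, -⟩
  · rcases z with _ | ⟨y, z⟩
    · exact hz
    · simp at hz
  · have := codes_christoffelWord hp hq
    rw [hz] at this
    -- A final step `+ p` ends at `p` or above, never at 0, wherever the walk starts.
    have key : ∀ s, ¬ Codes p q s (z ++ [a]) 0 := by
      clear hz this
      induction z with
      | nil => intro s hs; have := hs.2; simp only [Codes] at this; omega
      | cons x z ih => intro s hs; cases x <;> exact ih _ hs.2
    exact absurd this (key 0)

/-! ### Images and preimages of Christoffel words -/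

theorem IsChristoffel.lamA {w : Word} (h : IsChristoffel w) : IsChristoffel (lamA w) := by
  rcases h with (_ | _) | ⟨p, q, hp, hq, hpq⟩
  · exact .letter a
  · exact .proper 1 1 one_pos one_pos (by simp)
  · rw [lamA_christoffelWord hp hq]
    exact .proper _ _ hp (by omega) (by simpa using hpq)

theorem IsChristoffel.lamB {w : Word} (h : IsChristoffel w) : IsChristoffel (lamB w) := by
  rcases h with (_ | _) | ⟨p, q, hp, hq, hpq⟩
  · exact .proper 1 1 one_pos one_pos (by simp)
  · exact .letter b
  · rw [lamB_christoffelWord hp hq]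
    exact .proper _ _ (by omega) hq (by simpa using hpq)

/-- A Christoffel word is a letter, or `ab`, or the image of a Christoffel word containing both
letters under `λ_a` or `λ_b`. -/
theorem IsChristoffel.cases_lam {w : Word} (h : IsChristoffel w) :
    (∃ x, w = FreeMonoid.of x) ∨ w = FreeMonoid.of a * FreeMonoid.of b ∨
      (∃ u, IsChristoffel u ∧ w = ChristoffelWords.lamA u ∧
        0 < u.toList.count a ∧ 0 < u.toList.count b) ∨
      (∃ u, IsChristoffel u ∧ w = ChristoffelWords.lamB u ∧
        0 < u.toList.count a ∧ 0 < u.toList.count b) := by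
  rcases h with x | ⟨p, q, hp, hq, hpq⟩
  · exact .inl ⟨x, rfl⟩
  · rcases lt_trichotomy p q with hlt | rfl | hlt
    · obtain ⟨d, rfl⟩ := Nat.exists_eq_add_of_lt hlt
      refine .inr <| .inr <| .inl ⟨christoffelWord p (d + 1), ?_, ?_, ?_, ?_⟩
      · exact .proper _ _ hp (by omega) (by simpa [add_assoc] using hpq)
      · rw [lamA_christoffelWord hp (by omega), add_assoc]
      · rw [count_a_christoffelWord hp (by omega)]
        omega
      · rwa [count_b_christoffelWord hp (by omega)]
    · obtain rfl : p = 1 := by simpa using hpq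
      exact .inr <| .inl rfl
    · obtain ⟨d, rfl⟩ := Nat.exists_eq_add_of_lt hlt
      refine .inr <| .inr <| .inr ⟨christoffelWord (d + 1) q, ?_, ?_, ?_, ?_⟩
      · exact .proper _ _ (by omega) hq (by simpa [add_assoc] using hpq)
      · rw [lamB_christoffelWord (by omega) hq]
        congr 1
        omega
      · rwa [count_a_christoffelWord (by omega) hq]
      · rw [count_b_christoffelWord (by omega) hq]
        omega

/-- In a word `λ_a w` each `b` is paired with an `a`, in a word `λ_b u` each `a` with a `b`; a word
of both forms has no unpaired letters. -/
theorem count_eq_zero_of_lamA_eq_lamB {u w : Word} (h : lamA w = lamB u) :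
    w.toList.count a = 0 ∧ u.toList.count b = 0 := by
  have h := congrArg FreeMonoid.toList h
  rw [toList_lamA, toList_lamB] at h
  have hA := count_b_expandA w.toList
  have hB := count_a_expandB u.toList
  have lA := length_expandA w.toList
  have lB := length_expandB u.toList
  rw [length_eq_count_add_count, length_eq_count_add_count w.toList] at lA
  rw [length_eq_count_add_count, length_eq_count_add_count u.toList] at lB
  rw [h] at hA lA
  omega

theorem IsChristoffel.of_lamA {w : Word} (h : IsChristoffel (ChristoffelWords.lamA w)) :
    IsChristoffel w := by
  rcases h.cases_lam with ⟨x, hx⟩ | hw | ⟨u, hu, hw, -⟩ | ⟨u, -, hw, -, hpos⟩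
  · cases x
    · rw [lamA_injective (hx.trans lamA_of_a.symm)]
      exact .letter a
    · have := congrArg FreeMonoid.toList hx
      rw [toList_lamA] at this
      exact absurd this (expandA_ne_cons_b _ _)
  · rw [lamA_injective (hw.trans lamA_of_b.symm)]
    exact .letter b
  · rwa [lamA_injective hw]
  · exact absurd (count_eq_zero_of_lamA_eq_lamB hw).2 hpos.ne'

theorem IsChristoffel.of_lamB {w : Word} (h : IsChristoffel (ChristoffelWords.lamB w)) :
    IsChristoffel w := by
  rcases h.cases_lam with ⟨x, hx⟩ | hw | ⟨u, -, hw, hpos, -⟩ | ⟨u, hu, hw, -⟩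
  · cases x
    · have := congrArg FreeMonoid.toList hx
      rw [toList_lamB] at this
      rcases hw : w.toList with _ | ⟨_ | _, z⟩ <;> rw [hw] at this <;> simp [expandB] at this
    · rw [lamB_injective (hx.trans lamB_of_b.symm)]
      exact .letter b
  · rw [lamB_injective (hw.trans lamB_of_a.symm)]
    exact .letter a
  · exact absurd (count_eq_zero_of_lamA_eq_lamB hw.symm).1 hpos.ne'
  · rwa [lamB_injective hw]

theorem IsChristoffel.of_lam {v w : Word} (h : IsChristoffel (lam v w)) : IsChristoffel w := by
  induction v using FreeMonoid.inductionOn' with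
  | one => simpa using h
  | of_mul x v ih =>
    rw [map_mul] at h
    cases x
    · exact ih (IsChristoffel.of_lamA h)
    · exact ih (IsChristoffel.of_lamB h)

/-! ### Christoffel morphisms -/

theorem lamA_mem : lamA ∈ christoffelMorphisms := fun _ hw => hw.lamA

theorem lamB_mem : lamB ∈ christoffelMorphisms := fun _ hw => hw.lamB

theorem isChristoffel_ab : IsChristoffel (FreeMonoid.of a * FreeMonoid.of b) :=
  .proper 1 1 one_pos one_pos (by simp)

/-- If a product of two Christoffel words is the image under `λ_a` of a word containing `a`, then
both factors are images under `λ_a`. -/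
theorem IsChristoffel.exists_lamA_of_mul {x y u : Word} (hx : IsChristoffel x)
    (hy : IsChristoffel y) (h : x * y = ChristoffelWords.lamA u) (hu : 0 < u.toList.count a) :
    ∃ x' y', x = ChristoffelWords.lamA x' ∧ y = ChristoffelWords.lamA y' := by
  have hl : x.toList ++ y.toList = expandA u.toList := by
    rw [← toList_lamA, ← h, FreeMonoid.toList_mul]
  have hyb : ∀ z, y.toList ≠ b :: z := by
    intro z hz
    rw [hy.eq_b hz] at hl
    have hxa : x.toList = [a] := by
      rcases List.eq_nil_or_concat x.toList with h0 | ⟨z, c, hc⟩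
      · exact absurd h0 hx.toList_ne_nil
      · rw [List.concat_eq_append] at hc
        cases c
        · exact hx.eq_a hc
        · rw [hc] at hl
          -- In an image of `λ_a` every `b` directly follows an `a`, so `bb` cannot occur at the
          -- end.
          exact absurd (by simpa using hl) (append_b_b_ne_expandA u.toList z)
    rw [hxa] at hl
    have hub : u.toList = [b] := expandA_injective hl.symm
    simp [hub] at hu
  obtain ⟨x', y', hx', hy'⟩ := exists_expandA_of_append hl hyb
  exact ⟨.ofList x', .ofList y', FreeMonoid.toList.injective (by rw [hx', toList_lamA]; rfl),
    FreeMonoid.toList.injective (by rw [hy', toList_lamA]; rfl)⟩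

/-- If a product of two Christoffel words is the image under `λ_b` of a word containing `b`, then
both factors are images under `λ_b`. -/
theorem IsChristoffel.exists_lamB_of_mul {x y u : Word} (hx : IsChristoffel x)
    (hy : IsChristoffel y) (h : x * y = ChristoffelWords.lamB u) (hu : 0 < u.toList.count b) :
    ∃ x' y', x = ChristoffelWords.lamB x' ∧ y = ChristoffelWords.lamB y' := by
  have hl : x.toList ++ y.toList = expandB u.toList := by
    rw [← toList_lamB, ← h, FreeMonoid.toList_mul]
  have hxa : ∀ z, x.toList ≠ z ++ [a] := by
    intro z hz
    rw [hx.eq_a hz] at hl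
    have hyb : y.toList = [b] := by
      rcases hw : u.toList with _ | ⟨_ | _, w⟩ <;> rw [hw] at hl <;> simp [expandB] at hl
      exact hy.eq_b hl
    rw [hyb] at hl
    have hua : u.toList = [a] := expandB_injective hl.symm
    simp [hua] at hu
  obtain ⟨x', y', hx', hy'⟩ := exists_expandB_of_append hl hxa
  exact ⟨.ofList x', .ofList y', FreeMonoid.toList.injective (by rw [hx', toList_lamB]; rfl),
    FreeMonoid.toList.injective (by rw [hy', toList_lamB]; rfl)⟩

theorem exists_eq_mul {f h : Monoid.End Word} {x y : Word} (hx : f (FreeMonoid.of a) = h x)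
    (hy : f (FreeMonoid.of b) = h y) : ∃ g : Monoid.End Word, f = h * g := by
  refine ⟨FreeMonoid.lift fun | a => x | b => y, FreeMonoid.hom_eq fun c => ?_⟩
  cases c
  · exact hx
  · exact hy

theorem eq_one_of_map_ab {f : Monoid.End Word} (hf : f ∈ christoffelMorphisms)
    (h : f (FreeMonoid.of a * FreeMonoid.of b) = FreeMonoid.of a * FreeMonoid.of b) : f = 1 := by
  have ha := (hf _ (.letter a)).toList_ne_nil
  have hb := (hf _ (.letter b)).toList_ne_nil
  have hl : (f (FreeMonoid.of a)).toList ++ (f (FreeMonoid.of b)).toList = [a, b] := by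
    rw [← FreeMonoid.toList_mul, ← map_mul, h]
    rfl
  obtain ⟨ea, eb⟩ : (f (FreeMonoid.of a)).toList = [a] ∧ (f (FreeMonoid.of b)).toList = [b] := by
    revert ha hb hl
    generalize (f (FreeMonoid.of a)).toList = x
    generalize (f (FreeMonoid.of b)).toList = y
    rcases x with _ | ⟨c, _ | ⟨d, x⟩⟩ <;> simp
    intros
    simp_all
  refine FreeMonoid.hom_eq fun c => ?_
  cases c
  · exact FreeMonoid.toList.injective ea
  · exact FreeMonoid.toList.injective eb

theorem mem_closure_of_mem (n : ℕ) (f : Monoid.End Word) (hf : f ∈ christoffelMorphisms)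
    (hn : (f (FreeMonoid.of a * FreeMonoid.of b)).toList.length = n) :
    f ∈ Submonoid.closure {lamA, lamB} := by
  induction n using Nat.strong_induction_on generalizing f with
  | _ n ih =>
  have ha := hf _ (.letter a)
  have hb := hf _ (.letter b)
  have hab : f (FreeMonoid.of a * FreeMonoid.of b) = f (FreeMonoid.of a) * f (FreeMonoid.of b) :=
    map_mul f _ _
  rcases (hf _ isChristoffel_ab).cases_lam with
    ⟨x, hx⟩ | hw | ⟨u, -, hw, hua, hub⟩ | ⟨u, -, hw, hua, hub⟩
  · have := congrArg (fun w => (FreeMonoid.toList w).length) (hab.symm.trans hx)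
    have hla := List.length_pos_iff.2 ha.toList_ne_nil
    have hlb := List.length_pos_iff.2 hb.toList_ne_nil
    simp at this
    omega
  · rw [eq_one_of_map_ab hf hw]
    exact one_mem _
  · obtain ⟨x, y, hx, hy⟩ := ha.exists_lamA_of_mul hb (hab.symm.trans hw) hua
    obtain ⟨g, rfl⟩ := exists_eq_mul hx hy
    have hgab : g (FreeMonoid.of a * FreeMonoid.of b) = u :=
      lamA_injective hw
    refine mul_mem (Submonoid.subset_closure (by simp)) (ih _ ?_ g ?_ rfl)
    · rw [← hn, hgab, hw, toList_lamA, length_expandA]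
      omega
    · exact fun w hw => IsChristoffel.of_lamA (hf w hw)
  · obtain ⟨x, y, hx, hy⟩ := ha.exists_lamB_of_mul hb (hab.symm.trans hw) hub
    obtain ⟨g, rfl⟩ := exists_eq_mul hx hy
    have hgab : g (FreeMonoid.of a * FreeMonoid.of b) = u :=
      lamB_injective hw
    refine mul_mem (Submonoid.subset_closure (by simp)) (ih _ ?_ g ?_ rfl)
    · rw [← hn, hgab, hw, toList_lamB, length_expandB]
      omega
    · exact fun w hw => IsChristoffel.of_lamB (hf w hw)

end ChristoffelWords

theorem mainTheorem3 :
    ChristoffelWords.christoffelMorphisms =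
        Submonoid.closure {ChristoffelWords.lamA, ChristoffelWords.lamB} ∧
      ∀ v w : ChristoffelWords.Word,
        ChristoffelWords.IsChristoffel (ChristoffelWords.lam v w) →
          ChristoffelWords.IsChristoffel w := by
  refine ⟨le_antisymm ?_ ?_, fun v w h => h.of_lam⟩
  · exact fun f hf => ChristoffelWords.mem_closure_of_mem _ f hf rfl
  · rw [Submonoid.closure_le]
    rintro f (rfl | rfl)
    · exact ChristoffelWords.lamA_mem
    · exact ChristoffelWords.lamB_mem
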